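/- Let $S$ be a tree on $n$ nodes. A search tree on $S$ is a rooted tree $T$ with $V(T)=V(S)$ such that, for every child $x$ of the root $r$ of $T$, the subtree $T_x$ of $T$ rooted at $x$ is (recursively) a search tree on a connected component of $S\setminus r$. For $k\ge 1$, $T$ is a $k$-cut tree if for every node $x$ at most $k$ nodes outside $V(T_x)$ are adjacent in $S$ to a node of $V(T_x)$. A rotation at a node $x$ with parent $p$ in $T$ swaps the places of $x$ and $p$: $p$ becomes a child of $x$, and $x$ takes the former parent of $p$ (or becomes the root); a child $y$ of $x$ such that $V(T_y)$ contains a node adjacent to $p$ in $S$ becomes a child of $p$; all other nodes keep their parents. There is an absolute constant $c$ such that the following holds for every finite tree $S$ with $n\geq 1$ nodes and every integer $k\ge 1$. Any two $k$-cut search trees $T$, $T'$ on $S$ can be transformed into each other: there is a sequence of rotations that transforms $T$ into $T'$, with all intermediate trees being $k$-cut trees, such that - if $k\le n$, the number of rotations is at most $(2k-1)n-(k+1)k+1$; - starting with a pointer at the root of $T$, this sequence of rotations can be carried out with at most $c\,k^2 n$ operations in total, each of which either moves the pointer from the current node to its parent or to one of its children, or makes a rotation at the node where the pointer is (the pointer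 stays at that node). -/

import Mathlib

/-- A rooted tree with node set `V`, given by its root and its parent map. Only the root has no
parent, and every node reaches the root by going from parent to parent (so there are no cycles).
The children of a node carry no order. -/
@[ext]
structure RootedTreeOn (V : Type*) where
  /-- the parent of a node, `none` for the root -/
  parent : V → Option V
  /-- the root -/
  root : V
  parent_root : parent root = none
  reaches_root : ∀ x, Relation.ReflTransGen (fun a b => parent a = some b) x root

/-- The node set `V(T_x)` of the subtree of `T` rooted at `x`: all descendants of `x`, with `x`. -/
def RootedTreeOn.subtreeNodes {V : Type*} (T : RootedTreeOn V) (x : V) : Set V :=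
  {y | Relation.ReflTransGen (fun a b => T.parent a = some b) y x}

/-- `C` is the node set of a connected component of the induced subgraph `S[B]`. -/
def IsComponentOf {V : Type*} (S : SimpleGraph V) (B C : Set V) : Prop :=
  ∃ c : (S.induce B).ConnectedComponent, C = Subtype.val '' c.supp

/-- `IsSearchTreeOn S T r A`: the subtree `T_r` of `T` is a search tree on `S[A]`. That is, its node
set is `A`, and for every child `x` of `r`, the subtree `T_x` is a search tree on a connected
component of `S[A] \ r`. -/
inductive IsSearchTreeOn {V : Type*} (S : SimpleGraph V) (T : RootedTreeOn V) : V → Set V → Prop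
  | intro (r : V) (A : Set V)
      (nodes : T.subtreeNodes r = A)
      (C : V → Set V)
      (component : ∀ x, T.parent x = some r → IsComponentOf S (A \ {r}) (C x))
      (subtree : ∀ x, T.parent x = some r → IsSearchTreeOn S T x (C x)) :
      IsSearchTreeOn S T r A

/-- `T` is a search tree on the tree `S` (an STT on `S`). -/
def IsSTT {V : Type*} (S : SimpleGraph V) (T : RootedTreeOn V) : Prop :=
  IsSearchTreeOn S T T.root Set.univ

/-- The boundary `δ(A)`: the nodes outside `A` that are adjacent in `S` to a node of `A`. -/
def boundary {V : Type*} (S : SimpleGraph V) (A : Set V) : Set V :=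
  {u | u ∉ A ∧ ∃ v ∈ A, S.Adj u v}

/-- `T` is a `k`-cut search tree on `S`. -/
def IsKCut {V : Type*} (S : SimpleGraph V) (k : ℕ) (T : RootedTreeOn V) : Prop :=
  IsSTT S T ∧ ∀ x, (boundary S (T.subtreeNodes x)).ncard ≤ k

/-- `T'` is obtained from the search tree `T` on `S` by the rotation at the node `x`, that is, by
rotating the edge between `x` and its parent `p`: `x` and `p` swap places, a child of `x` whose
subtree contains a node adjacent to `p` in `S` becomes a child of `p`, and all other nodes keep
their parent. -/
def IsRotation {V : Type*} (S : SimpleGraph V) (T : RootedTreeOn V) (x : V) (T' : RootedTreeOn V) :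
    Prop :=
  ∃ p, T.parent x = some p ∧
    T'.parent x = T.parent p ∧
    T'.parent p = some x ∧
    (∀ y, T.parent y = some x → (∃ z ∈ T.subtreeNodes y, S.Adj p z) → T'.parent y = some p) ∧
    (∀ y, y ≠ x → y ≠ p →
      ¬ (T.parent y = some x ∧ ∃ z ∈ T.subtreeNodes y, S.Adj p z) → T'.parent y = T.parent y)

/-- `RotationSeq S k T T' L`: the rotations at the nodes listed in `L`, one after the other,
transform `T` into `T'`, and all trees along the way, `T` and `T'` included, are `k`-cut trees. -/
inductive RotationSeq {V : Type*} (S : SimpleGraph V) (k : ℕ) :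
    RootedTreeOn V → RootedTreeOn V → List V → Prop
  | nil (T : RootedTreeOn V) (hT : IsKCut S k T) : RotationSeq S k T T []
  | cons (T T₁ T' : RootedTreeOn V) (x : V) (L : List V) (hT : IsKCut S k T)
      (rot : IsRotation S T x T₁) (rest : RotationSeq S k T₁ T' L) :
      RotationSeq S k T T' (x :: L)

/-- A pointer move in `T`, from the node `x` to its parent or to one of its children. -/
def IsPointerMove {V : Type*} (T : RootedTreeOn V) (x y : V) : Prop :=
  T.parent x = some y ∨ T.parent y = some x

/-- `PointerRun S k T x T' x' L m`: starting from the tree `T` with the pointer at `x`, one can reach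
the tree `T'` with the pointer at `x'` by a sequence of operations consisting of `m` pointer moves
and of the rotations at the nodes listed in `L`, in this order, each of them made at the node where
the pointer is (and the pointer stays at this node). All trees along the way are `k`-cut trees. -/
inductive PointerRun {V : Type*} (S : SimpleGraph V) (k : ℕ) :
    RootedTreeOn V → V → RootedTreeOn V → V → List V → ℕ → Prop
  | done (T : RootedTreeOn V) (x : V) (hT : IsKCut S k T) : PointerRun S k T x T x [] 0
  | move (T T' : RootedTreeOn V) (x y x' : V) (L : List V) (m : ℕ) (hmove : IsPointerMove T x y)
      (rest : PointerRun S k T y T' x' L m) : PointerRun S k T x T' x' L (m + 1)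
  | rotate (T T₁ T' : RootedTreeOn V) (x x' : V) (L : List V) (m : ℕ) (hT : IsKCut S k T)
      (rot : IsRotation S T x T₁) (rest : PointerRun S k T₁ x T' x' L m) :
      PointerRun S k T x T' x' (x :: L) m

/-! Both trees are reduced to `1`-cut trees, the two `1`-cut trees are joined, and the second
reduction is run backwards (`PointerRun.reverse`). A `1`-cut tree is just `S` with a chosen root, so
joining two of them means moving the root along a path, at most `n - 1` rotations.

The reduction lowers the cut by one at a time. In a `(j + 1)`-cut tree call a node overfull if its
subtree has `j + 1` boundary nodes. If `x` is overfull and its parent `p` is not, the rotation at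
`x` removes `x` from the overfull nodes and adds none (`IsRotationAt.overfull_eq`): the new subtree
of `x` has the old node set of `T_p`, and since `S` has no cycles the new subtree of `p` has at most
`j` boundary nodes (`IsRotationAt.ncard_boundary_upper`). As boundary nodes are proper ancestors, a
highest overfull node has at least `j + 1` proper ancestors, none overfull; hence at most `n - (j +
1)` rotations suffice.

Summing over `j = 1, ..., k - 1`, doubling and adding `n - 1` gives `(2k - 1)n - (k + 1)k + 1`. A
depth-first traversal makes each pass with at most `3n` pointer moves, so `O(kn)` operations suffice
in all, which is within `c k² n`. -/

open Relation

/-! ### Descendants and ancestors in a rooted tree -/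

namespace RootedTreeOn

variable {V : Type*} {T : RootedTreeOn V} {x y z w a b : V}

theorem mem_subtreeNodes_self (T : RootedTreeOn V) (x : V) : x ∈ T.subtreeNodes x :=
  ReflTransGen.refl

theorem mem_subtreeNodes_of_parent (h : T.parent y = some w) (hw : w ∈ T.subtreeNodes z) :
    y ∈ T.subtreeNodes z :=
  ReflTransGen.head h hw

theorem mem_subtreeNodes_trans (h : x ∈ T.subtreeNodes y) (h' : y ∈ T.subtreeNodes z) :
    x ∈ T.subtreeNodes z :=
  ReflTransGen.trans h h'

theorem mem_subtreeNodes_cases (h : y ∈ T.subtreeNodes z) :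
    y = z ∨ ∃ w, T.parent y = some w ∧ w ∈ T.subtreeNodes z :=
  ReflTransGen.cases_head h

theorem mem_subtreeNodes_cases_child (h : y ∈ T.subtreeNodes z) :
    y = z ∨ ∃ w, T.parent w = some z ∧ y ∈ T.subtreeNodes w := by
  rcases ReflTransGen.cases_tail h with h | ⟨w, h1, h2⟩
  · exact .inl h.symm
  · exact .inr ⟨w, h2, h1⟩

theorem parent_mem_subtreeNodes (h : y ∈ T.subtreeNodes z) (hne : y ≠ z)
    (hp : T.parent y = some w) : w ∈ T.subtreeNodes z := by
  obtain h | ⟨w', h1, h2⟩ := mem_subtreeNodes_cases h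
  · exact absurd h hne
  · rw [hp] at h1
    exact (Option.some.inj h1) ▸ h2

theorem mem_subtreeNodes_root (T : RootedTreeOn V) (x : V) : x ∈ T.subtreeNodes T.root :=
  T.reaches_root x

theorem eq_root_of_parent_eq_none (h : T.parent x = none) : x = T.root := by
  obtain h' | ⟨w, h1, -⟩ := mem_subtreeNodes_cases (T.mem_subtreeNodes_root x)
  · exact h'
  · simp [h] at h1

/-- A cycle through `x` would also pass through its parent, and so on up to the root, which has no
parent. -/
theorem parent_notMem_subtreeNodes (h : T.parent x = some w) : w ∉ T.subtreeNodes x := by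
  revert w
  induction T.reaches_root x using ReflTransGen.head_induction_on with
  | refl => intro w h; simp [T.parent_root] at h
  | head hxy _ ih =>
    intro w h hw
    obtain rfl : _ = w := Option.some.inj (hxy.symm.trans h)
    obtain h' | ⟨v, h1, h2⟩ := mem_subtreeNodes_cases hw
    · subst h'; exact ih h (T.mem_subtreeNodes_self _)
    · exact ih h1 (mem_subtreeNodes_trans h2 (mem_subtreeNodes_of_parent h (T.mem_subtreeNodes_self _)))

theorem subtreeNodes_antisymm (h : x ∈ T.subtreeNodes y) (h' : y ∈ T.subtreeNodes x) : x = y := by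
  obtain h1 | ⟨w, h1, h2⟩ := mem_subtreeNodes_cases h
  · exact h1
  · exact absurd (mem_subtreeNodes_trans h2 h') (parent_notMem_subtreeNodes h1)

theorem parent_ne_self (h : T.parent x = some w) : w ≠ x := by
  rintro rfl
  exact parent_notMem_subtreeNodes h (T.mem_subtreeNodes_self _)

theorem subtreeNodes_total (ha : y ∈ T.subtreeNodes a) (hb : y ∈ T.subtreeNodes b) :
    a ∈ T.subtreeNodes b ∨ b ∈ T.subtreeNodes a :=
  ReflTransGen.total_of_right_unique
    (fun _ _ _ h h' => Option.some.inj (h.symm.trans h')) ha hb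

/-- A local characterization of the node set of a subtree. -/
theorem subtreeNodes_eq {A : Set V} (hz : z ∈ A)
    (down : ∀ y w, T.parent y = some w → w ∈ A → y ∈ A)
    (up : ∀ y ∈ A, y ≠ z → ∃ w ∈ A, T.parent y = some w) : T.subtreeNodes z = A := by
  ext y
  constructor
  · intro h
    induction h using ReflTransGen.head_induction_on with
    | refl => exact hz
    | head h _ ih => exact down _ _ h ih
  · intro h
    induction T.reaches_root y using ReflTransGen.head_induction_on with
    | refl =>
      by_contra hne
      obtain ⟨w, -, hw⟩ := up _ h (fun e => hne (e ▸ T.mem_subtreeNodes_self _))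
      simp [T.parent_root] at hw
    | @head y w hyw _ ih =>
      by_cases hy : y = z
      · exact hy ▸ T.mem_subtreeNodes_self _
      · obtain ⟨w', hw, hw'⟩ := up _ h hy
        obtain rfl : w = w' := Option.some.inj (hyw.symm.trans hw')
        exact mem_subtreeNodes_of_parent hw' (ih hw)

/-- The ancestors of `x`, including `x` itself. -/
def ancestors (T : RootedTreeOn V) (x : V) : Set V := {a | x ∈ T.subtreeNodes a}

theorem mem_ancestors_self (T : RootedTreeOn V) (x : V) : x ∈ T.ancestors x :=
  T.mem_subtreeNodes_self x

theorem ancestors_of_parent (h : T.parent x = some w) :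
    T.ancestors x = insert x (T.ancestors w) := by
  ext a
  constructor
  · intro ha
    by_cases hx : x = a
    · exact .inl hx.symm
    · exact .inr (parent_mem_subtreeNodes ha hx h)
  · rintro (rfl | ha)
    · exact T.mem_ancestors_self _
    · exact mem_subtreeNodes_of_parent h ha

theorem ancestors_root (T : RootedTreeOn V) : T.ancestors T.root = {T.root} := by
  ext a
  constructor
  · intro ha
    exact subtreeNodes_antisymm (T.mem_subtreeNodes_root a) ha
  · rintro rfl
    exact T.mem_ancestors_self _

theorem notMem_ancestors_of_parent (h : T.parent x = some w) : x ∉ T.ancestors w :=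
  parent_notMem_subtreeNodes h

theorem ncard_ancestors_of_parent [Finite V] (h : T.parent x = some w) :
    (T.ancestors x).ncard = (T.ancestors w).ncard + 1 := by
  rw [ancestors_of_parent h, Set.ncard_insert_of_notMem (notMem_ancestors_of_parent h)]

end RootedTreeOn

/-! ### A local description of search trees -/

open RootedTreeOn

/-- A local description of the search trees on `S`: adjacent nodes are comparable, and every node
is adjacent to each of its child subtrees. -/
structure IsLocalSTT {V : Type*} (S : SimpleGraph V) (T : RootedTreeOn V) : Prop where
  comparable : ∀ u v, S.Adj u v → u ∈ T.subtreeNodes v ∨ v ∈ T.subtreeNodes u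
  attached : ∀ y p, T.parent y = some p → ∃ z ∈ T.subtreeNodes y, S.Adj p z

section SearchTree

variable {V : Type*} {S : SimpleGraph V} {T : RootedTreeOn V} {A B : Set V} {r : V}

theorem IsComponentOf.preconnected {C : Set V} (h : IsComponentOf S B C) :
    (S.induce C).Preconnected := by
  obtain ⟨c, rfl⟩ := h
  have hc := c.connected_toSimpleGraph.preconnected
  let f : c.toSimpleGraph →g S.induce (Subtype.val '' c.supp) :=
    { toFun := fun u => ⟨u.1.1, u.1, u.2, rfl⟩
      map_rel' := fun h => h }
  rintro ⟨_, u, hu, rfl⟩ ⟨_, v, hv, rfl⟩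
  exact (hc ⟨u, hu⟩ ⟨v, hv⟩).map f

theorem IsComponentOf.subset {C : Set V} (h : IsComponentOf S B C) : C ⊆ B := by
  obtain ⟨c, rfl⟩ := h
  rintro _ ⟨u, -, rfl⟩
  exact u.2

theorem IsComponentOf.mem_of_adj {C : Set V} (h : IsComponentOf S B C) {u v : V} (hu : u ∈ C)
    (hv : v ∈ B) (huv : S.Adj u v) : v ∈ C := by
  obtain ⟨c, rfl⟩ := h
  obtain ⟨u, hu, rfl⟩ := hu
  refine ⟨⟨v, hv⟩, ?_, rfl⟩
  exact c.mem_supp_of_adj_mem_supp hu (by simpa using huv)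

/-- A set that is closed under adjacency within a preconnected set is all of it. -/
theorem subset_of_preconnected_of_closed (hA : (S.induce A).Preconnected) {u : V} (huA : u ∈ A)
    (huB : u ∈ B) (h : ∀ v ∈ B, ∀ w ∈ A, S.Adj v w → w ∈ B) : A ⊆ B := by
  intro v hv
  obtain ⟨p⟩ := hA ⟨u, huA⟩ ⟨v, hv⟩
  suffices H : ∀ a b : A, (S.induce A).Walk a b → a.1 ∈ B → b.1 ∈ B from H _ _ p huB
  intro a b p
  induction p with
  | nil => exact id
  | cons hadj _ ih => exact fun ha => ih (h _ ha _ (Subtype.prop _) hadj)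

theorem isComponentOf_of_closed {C : Set V} (hC : (S.induce C).Preconnected) {u : V} (hu : u ∈ C)
    (hCB : C ⊆ B) (h : ∀ v ∈ C, ∀ w ∈ B, S.Adj v w → w ∈ C) : IsComponentOf S B C := by
  refine ⟨(S.induce B).connectedComponentMk ⟨u, hCB hu⟩, Set.Subset.antisymm ?_ ?_⟩
  · intro v hv
    refine ⟨⟨v, hCB hv⟩, ?_, rfl⟩
    rw [SimpleGraph.ConnectedComponent.mem_supp_iff, SimpleGraph.ConnectedComponent.eq]
    exact (hC ⟨v, hv⟩ ⟨u, hu⟩).map (S.induceHomOfLE hCB).toHom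
  · refine subset_of_preconnected_of_closed (IsComponentOf.preconnected ⟨_, rfl⟩) (u := u)
      ⟨_, rfl, rfl⟩ hu fun v hv w hw => h v hv w (IsComponentOf.subset ⟨_, rfl⟩ hw)

theorem IsSearchTreeOn.subtreeNodes_eq (h : IsSearchTreeOn S T r A) : T.subtreeNodes r = A := by
  cases h; assumption

theorem IsSearchTreeOn.comparable (h : IsSearchTreeOn S T r A) :
    ∀ u ∈ A, ∀ v ∈ A, S.Adj u v → u ∈ T.subtreeNodes v ∨ v ∈ T.subtreeNodes u := by
  induction h with
  | intro r A nodes C component subtree ih =>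
    subst nodes
    have key : ∀ u ∈ T.subtreeNodes r, ∀ v ∈ T.subtreeNodes r, S.Adj u v → u ≠ r → v ≠ r →
        u ∈ T.subtreeNodes v ∨ v ∈ T.subtreeNodes u := by
      intro u hu v hv huv hur hvr
      obtain h | ⟨x, hx, hux⟩ := mem_subtreeNodes_cases_child hu
      · exact absurd h hur
      have huC : u ∈ C x := (subtree x hx).subtreeNodes_eq ▸ hux
      exact ih x hx u huC v ((component x hx).mem_of_adj huC ⟨hv, hvr⟩ huv) huv
    intro u hu v hv huv
    by_cases hur : u = r
    · subst hur; exact .inr hv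
    by_cases hvr : v = r
    · subst hvr; exact .inl hu
    exact key u hu v hv huv hur hvr

theorem IsSearchTreeOn.attached (h : IsSearchTreeOn S T r A) (hA : (S.induce A).Preconnected) :
    ∀ y p, T.parent y = some p → p ∈ A → ∃ z ∈ T.subtreeNodes y, S.Adj p z := by
  induction h with
  | intro r A nodes C component subtree ih =>
    subst nodes
    intro y p hyp hp
    obtain rfl | ⟨x, hx, hpx⟩ := mem_subtreeNodes_cases_child hp
    -- Otherwise `T_y`, a component of the rest of the set without `p`, would be closed under
    -- adjacency in the whole connected set, which contains `p`.
    · by_contra! hno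
      have hyC : T.subtreeNodes y = C y := (subtree y hyp).subtreeNodes_eq
      have hsub := subset_of_preconnected_of_closed (B := T.subtreeNodes y) hA
        (mem_subtreeNodes_of_parent hyp (T.mem_subtreeNodes_self p)) (T.mem_subtreeNodes_self y)
        (by
          intro v hv w hw hvw
          by_cases hwp : w = p
          · subst hwp; exact absurd hvw.symm (hno v hv)
          · rw [hyC] at hv ⊢
            exact (component y hyp).mem_of_adj hv ⟨hw, hwp⟩ hvw)
      exact parent_notMem_subtreeNodes hyp (hsub (T.mem_subtreeNodes_self p))
    · exact ih x hx (component x hx).preconnected y p hyp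
        ((subtree x hx).subtreeNodes_eq ▸ hpx)

theorem IsSTT.isLocalSTT (hS : S.Preconnected) (h : IsSTT S T) : IsLocalSTT S T where
  comparable u v := IsSearchTreeOn.comparable h u trivial v trivial
  attached y p hyp := IsSearchTreeOn.attached h
    (fun u v => (hS u.1 v.1).map
      ({ toFun := fun a => ⟨a, trivial⟩, map_rel' := fun h => h } : S →g S.induce Set.univ))
    y p hyp trivial

namespace IsLocalSTT

/-- By induction each child subtree is connected, and `attached` joins it to `x`. -/
theorem preconnected [Finite V] (h : IsLocalSTT S T) (x : V) :
    (S.induce (T.subtreeNodes x)).Preconnected := by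
  induction hn : (T.subtreeNodes x).ncard using Nat.strong_induction_on generalizing x with
  | _ n ih =>
    subst hn
    suffices H : ∀ u : T.subtreeNodes x,
        (S.induce (T.subtreeNodes x)).Reachable u ⟨x, T.mem_subtreeNodes_self x⟩ from
      fun u v => (H u).trans (H v).symm
    rintro ⟨u, hu⟩
    obtain rfl | ⟨y, hy, huy⟩ := mem_subtreeNodes_cases_child hu
    · exact .refl _
    have hsub : T.subtreeNodes y ⊆ T.subtreeNodes x := fun v hv =>
      mem_subtreeNodes_trans hv (mem_subtreeNodes_of_parent hy (T.mem_subtreeNodes_self x))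
    have hlt : (T.subtreeNodes y).ncard < (T.subtreeNodes x).ncard :=
      Set.ncard_lt_ncard ⟨hsub, fun hh => parent_notMem_subtreeNodes hy (hh (T.mem_subtreeNodes_self x))⟩
    obtain ⟨z, hz, hxz⟩ := h.attached y x hy
    have h1 := (ih _ hlt y rfl ⟨u, huy⟩ ⟨z, hz⟩).map
      (S.induceHomOfLE hsub).toHom
    exact h1.trans (SimpleGraph.Adj.reachable (G := S.induce (T.subtreeNodes x))
      (u := ⟨z, hsub hz⟩) (v := ⟨x, T.mem_subtreeNodes_self x⟩) hxz.symm)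

theorem isSearchTreeOn [Finite V] (h : IsLocalSTT S T) (r : V) :
    IsSearchTreeOn S T r (T.subtreeNodes r) := by
  induction hn : (T.subtreeNodes r).ncard using Nat.strong_induction_on generalizing r with
  | _ n ih =>
    subst hn
    have hsub : ∀ x, T.parent x = some r → T.subtreeNodes x ⊆ T.subtreeNodes r := fun x hx v hv =>
      mem_subtreeNodes_trans hv (mem_subtreeNodes_of_parent hx (T.mem_subtreeNodes_self r))
    refine .intro r _ rfl T.subtreeNodes (fun x hx => ?_) (fun x hx => ih _ (Set.ncard_lt_ncard
      ⟨hsub x hx, fun hh => parent_notMem_subtreeNodes hx (hh (T.mem_subtreeNodes_self r))⟩) x rfl)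
    refine isComponentOf_of_closed (h.preconnected x) (T.mem_subtreeNodes_self x)
      (fun v hv => ⟨hsub x hx hv, ?_⟩) ?_
    · rintro rfl; exact parent_notMem_subtreeNodes hx hv
    · rintro u hu v ⟨hv, hvr⟩ huv
      -- Comparability makes `T_x` closed under adjacency away from `r`: a neighbour above `u`
      -- either lies in `T_x` or is an ancestor of `r`, hence `r` itself.
      obtain huv | hvu := h.comparable u v huv
      · obtain h1 | h1 := subtreeNodes_total huv hu
        · exact h1
        · by_cases hxv : x = v
          · exact hxv ▸ T.mem_subtreeNodes_self x
          · exact absurd (subtreeNodes_antisymm hv (parent_mem_subtreeNodes h1 hxv hx)) hvr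
      · exact mem_subtreeNodes_trans hvu hu

theorem isSTT [Finite V] (h : IsLocalSTT S T) : IsSTT S T := by
  have : T.subtreeNodes T.root = Set.univ := Set.eq_univ_of_forall T.mem_subtreeNodes_root
  rw [IsSTT, ← this]
  exact h.isSearchTreeOn T.root

/-- If `S` is acyclic, a node has at most one neighbour in a subtree that does not contain it. -/
theorem neighbor_unique [Finite V] (h : IsLocalSTT S T) (hS : S.IsAcyclic) {x b u v : V}
    (hb : b ∉ T.subtreeNodes x) (hu : u ∈ T.subtreeNodes x) (hv : v ∈ T.subtreeNodes x)
    (hbu : S.Adj b u) (hbv : S.Adj b v) : u = v := by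
  by_contra hne
  -- Edges of a forest are bridges, but `b`, `v` and a path inside the subtree from `v` to `u`
  -- bypass the edge `bu`.
  have hbridge := SimpleGraph.isAcyclic_iff_forall_adj_isBridge.1 hS hbu
  refine hbridge ?_
  have h1 : (S.deleteEdges {s(b, u)}).Adj b v := by
    simp [hbv, hbv.ne', Ne.symm hne]
  let f : S.induce (T.subtreeNodes x) →g S.deleteEdges {s(b, u)} :=
    { toFun := Subtype.val
      map_rel' := by
        rintro ⟨c, hc⟩ ⟨d, hd⟩ hcd
        have hcb : c ≠ b := fun e => hb (e ▸ hc)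
        have hdb : d ≠ b := fun e => hb (e ▸ hd)
        have hcd' : S.Adj c d := hcd
        simp [hcd', hcb, hdb] }
  exact h1.reachable.trans ((h.preconnected x ⟨v, hv⟩ ⟨u, hu⟩).map f)

end IsLocalSTT

end SearchTree

/-! ### Rotations: existence, effect on subtrees, inverses -/

/-- `T'` arises from `T` by rotating the edge between `x` and its parent `p`. -/
structure IsRotationAt {V : Type*} (S : SimpleGraph V) (T : RootedTreeOn V) (x p : V)
    (T' : RootedTreeOn V) : Prop where
  parent : T.parent x = some p
  parent_lower : T'.parent x = T.parent p
  parent_upper : T'.parent p = some x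
  parent_moved : ∀ y, T.parent y = some x → (∃ z ∈ T.subtreeNodes y, S.Adj p z) →
    T'.parent y = some p
  parent_other : ∀ y, y ≠ x → y ≠ p →
    ¬ (T.parent y = some x ∧ ∃ z ∈ T.subtreeNodes y, S.Adj p z) → T'.parent y = T.parent y

section Rotation

variable {V : Type*} {S : SimpleGraph V} {T T' : RootedTreeOn V} {x p : V}

theorem IsRotationAt.isRotation (h : IsRotationAt S T x p T') : IsRotation S T x T' :=
  ⟨p, h.parent, h.parent_lower, h.parent_upper, h.parent_moved, h.parent_other⟩

theorem IsRotation.exists_isRotationAt (h : IsRotation S T x T') : ∃ p, IsRotationAt S T x p T' :=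
  let ⟨p, h1, h2, h3, h4, h5⟩ := h
  ⟨p, h1, h2, h3, h4, h5⟩

theorem exists_isRotationAt (S : SimpleGraph V) (hx : T.parent x = some p) :
    ∃ T', IsRotationAt S T x p T' := by
  classical
  have hpx : p ≠ x := parent_ne_self hx
  let f : V → Option V := fun z =>
    if z = x then T.parent p else if z = p then some x else
      if T.parent z = some x ∧ ∃ w ∈ T.subtreeNodes z, S.Adj p w then some p else T.parent z
  have fx : f x = T.parent p := by simp [f]
  have fp : f p = some x := by simp [f, hpx]
  have fN : ∀ y, T.parent y = some x → (∃ z ∈ T.subtreeNodes y, S.Adj p z) → f y = some p := by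
    intro y hy hz
    have hyx : y ≠ x := (parent_ne_self hy).symm
    have hyp : y ≠ p := by
      rintro rfl
      exact parent_notMem_subtreeNodes hx
        (mem_subtreeNodes_of_parent hy (T.mem_subtreeNodes_self x))
    simp only [f]
    rw [if_neg hyx, if_neg hyp, if_pos ⟨hy, hz⟩]
  have fo : ∀ y, y ≠ x → y ≠ p →
      ¬ (T.parent y = some x ∧ ∃ z ∈ T.subtreeNodes y, S.Adj p z) → f y = T.parent y := by
    intro y h1 h2 h3
    simp only [f]
    rw [if_neg h1, if_neg h2, if_neg h3]
  -- The root changes only if `p` was the root.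
  let r : V := if p = T.root then x else T.root
  have hxr : x ≠ T.root := by rintro rfl; simp [T.parent_root] at hx
  have fr : f r = none := by
    by_cases hp : p = T.root
    · simp only [r, if_pos hp, fx]
      rw [hp, T.parent_root]
    · simp only [r, if_neg hp]
      rw [fo _ hxr.symm (Ne.symm hp) (by simp [T.parent_root]), T.parent_root]
  refine ⟨⟨f, r, fr, fun z => ?_⟩, hx, fx, fp, fN, fo⟩
  induction T.reaches_root z using ReflTransGen.head_induction_on with
  | refl =>
    by_cases hp : p = T.root
    · have hr : r = x := if_pos hp
      rw [hr, ← hp]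
      exact .single fp
    · have hr : r = T.root := if_neg hp
      rw [hr]
  | @head z w hzw _ ih =>
    by_cases hzx : z = x
    · subst hzx
      obtain rfl : p = w := Option.some.inj (hx.symm.trans hzw)
      obtain h | ⟨v, h1, h2⟩ := ReflTransGen.cases_head ih
      · rw [← h, fp] at fr
        cases fr
      · rw [fp] at h1
        cases h1
        exact h2
    by_cases hzp : z = p
    · subst hzp
      exact .head fp (.head (fx.trans hzw) ih)
    by_cases hN : T.parent z = some x ∧ ∃ w ∈ T.subtreeNodes z, S.Adj p w
    · obtain rfl : x = w := Option.some.inj (hN.1.symm.trans hzw)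
      exact .head (fN z hN.1 hN.2) (.head fp ih)
    · exact .head ((fo z hzx hzp hN).trans hzw) ih

namespace IsRotationAt

variable (h : IsRotationAt S T x p T')
include h

theorem mem_upper : x ∈ T.subtreeNodes p :=
  mem_subtreeNodes_of_parent h.parent (T.mem_subtreeNodes_self p)

theorem upper_notMem : p ∉ T.subtreeNodes x := parent_notMem_subtreeNodes h.parent

theorem upper_ne : p ≠ x := parent_ne_self h.parent

theorem subtreeNodes_lower : T'.subtreeNodes x = T.subtreeNodes p := by
  refine subtreeNodes_eq h.mem_upper ?_ ?_
  · intro y w hyw hw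
    by_cases hyx : y = x
    · exact hyx ▸ h.mem_upper
    by_cases hyp : y = p
    · exact hyp ▸ T.mem_subtreeNodes_self p
    by_cases hN : T.parent y = some x ∧ ∃ z ∈ T.subtreeNodes y, S.Adj p z
    · exact mem_subtreeNodes_of_parent hN.1 h.mem_upper
    · rw [h.parent_other y hyx hyp hN] at hyw
      exact mem_subtreeNodes_of_parent hyw hw
  · intro y hy hyx
    by_cases hyp : y = p
    · exact ⟨x, h.mem_upper, hyp ▸ h.parent_upper⟩
    by_cases hN : T.parent y = some x ∧ ∃ z ∈ T.subtreeNodes y, S.Adj p z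
    · exact ⟨p, T.mem_subtreeNodes_self p, h.parent_moved y hN.1 hN.2⟩
    · obtain hyp' | ⟨w, h1, h2⟩ := mem_subtreeNodes_cases hy
      · exact absurd hyp' hyp
      · exact ⟨w, h2, (h.parent_other y hyx hyp hN).trans h1⟩

theorem subtreeNodes_other {z : V} (hzx : z ≠ x) (hzp : z ≠ p) :
    T'.subtreeNodes z = T.subtreeNodes z := by
  have hxp : x ∈ T.subtreeNodes z → p ∈ T.subtreeNodes z := fun hx =>
    parent_mem_subtreeNodes hx hzx.symm h.parent
  have hpx : p ∈ T.subtreeNodes z → x ∈ T.subtreeNodes z :=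
    mem_subtreeNodes_of_parent h.parent
  refine subtreeNodes_eq (T.mem_subtreeNodes_self z) ?_ ?_
  · intro y w hyw hw
    by_cases hyx : y = x
    · rw [hyx, h.parent_lower] at hyw
      exact hyx ▸ hpx (mem_subtreeNodes_of_parent hyw hw)
    by_cases hyp : y = p
    · rw [hyp, h.parent_upper] at hyw
      cases hyw
      exact hyp ▸ hxp hw
    by_cases hN : T.parent y = some x ∧ ∃ z ∈ T.subtreeNodes y, S.Adj p z
    · rw [h.parent_moved y hN.1 hN.2] at hyw
      cases hyw
      exact mem_subtreeNodes_of_parent hN.1 (hpx hw)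
    · rw [h.parent_other y hyx hyp hN] at hyw
      exact mem_subtreeNodes_of_parent hyw hw
  · intro y hy hyz
    by_cases hyx : y = x
    · subst hyx
      obtain hp | ⟨w, h1, h2⟩ := mem_subtreeNodes_cases (hxp hy)
      · exact absurd hp.symm hzp
      · exact ⟨w, h2, h.parent_lower.trans h1⟩
    by_cases hyp : y = p
    · subst hyp
      exact ⟨x, hpx hy, h.parent_upper⟩
    by_cases hN : T.parent y = some x ∧ ∃ z ∈ T.subtreeNodes y, S.Adj p z
    · exact ⟨p, hxp (parent_mem_subtreeNodes hy hyz hN.1), h.parent_moved y hN.1 hN.2⟩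
    · obtain hyz' | ⟨w, h1, h2⟩ := mem_subtreeNodes_cases hy
      · exact absurd hyz' hyz
      · exact ⟨w, h2, (h.parent_other y hyx hyp hN).trans h1⟩

theorem subtreeNodes_upper : T'.subtreeNodes p =
    {v ∈ T.subtreeNodes p | v ∈ T.subtreeNodes x →
      ∃ y, T.parent y = some x ∧ (∃ z ∈ T.subtreeNodes y, S.Adj p z) ∧ v ∈ T.subtreeNodes y} := by
  refine subtreeNodes_eq ⟨T.mem_subtreeNodes_self p, fun hp => absurd hp h.upper_notMem⟩ ?_ ?_
  · rintro v w hvw ⟨hw, hw'⟩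
    by_cases hvx : v = x
    · rw [hvx, h.parent_lower] at hvw
      exact absurd hw (parent_notMem_subtreeNodes hvw)
    by_cases hvp : v = p
    · subst hvp
      exact ⟨T.mem_subtreeNodes_self v, fun hp => absurd hp h.upper_notMem⟩
    by_cases hN : T.parent v = some x ∧ ∃ z ∈ T.subtreeNodes v, S.Adj p z
    · exact ⟨mem_subtreeNodes_of_parent hN.1 h.mem_upper,
        fun _ => ⟨v, hN.1, hN.2, T.mem_subtreeNodes_self v⟩⟩
    · rw [h.parent_other v hvx hvp hN] at hvw
      refine ⟨mem_subtreeNodes_of_parent hvw hw, fun hv => ?_⟩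
      obtain ⟨y, h1, h2, h3⟩ := hw' (parent_mem_subtreeNodes hv hvx hvw)
      exact ⟨y, h1, h2, mem_subtreeNodes_of_parent hvw h3⟩
  · rintro v ⟨hv, hv'⟩ hvp
    by_cases hN : T.parent v = some x ∧ ∃ z ∈ T.subtreeNodes v, S.Adj p z
    · exact ⟨p, ⟨T.mem_subtreeNodes_self p, fun hp => absurd hp h.upper_notMem⟩,
        h.parent_moved v hN.1 hN.2⟩
    have hvx : v ≠ x := by
      rintro rfl
      obtain ⟨y, h1, -, h3⟩ := hv' (T.mem_subtreeNodes_self v)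
      exact parent_notMem_subtreeNodes h1 h3
    obtain hvp' | ⟨w, h1, h2⟩ := mem_subtreeNodes_cases hv
    · exact absurd hvp' hvp
    refine ⟨w, ⟨h2, fun hw => ?_⟩, (h.parent_other v hvx hvp hN).trans h1⟩
    obtain ⟨y, h3, h4, h5⟩ := hv' (mem_subtreeNodes_of_parent h1 hw)
    refine ⟨y, h3, h4, parent_mem_subtreeNodes h5 ?_ h1⟩
    rintro rfl
    exact hN ⟨h3, h4⟩

theorem mem_subtreeNodes_upper {v : V} : v ∈ T'.subtreeNodes p ↔
    v ∈ T.subtreeNodes p ∧ (v ∈ T.subtreeNodes x →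
      ∃ y, T.parent y = some x ∧ (∃ z ∈ T.subtreeNodes y, S.Adj p z) ∧ v ∈ T.subtreeNodes y) := by
  rw [h.subtreeNodes_upper, Set.mem_ofPred_eq]

theorem isLocalSTT (hT : IsLocalSTT S T) : IsLocalSTT S T' := by
  constructor
  · suffices H : ∀ u v, S.Adj u v → v ∈ T.subtreeNodes u →
        u ∈ T'.subtreeNodes v ∨ v ∈ T'.subtreeNodes u by
      intro u v huv
      obtain h1 | h1 := hT.comparable u v huv
      · exact (H v u huv.symm h1).symm
      · exact H u v huv h1
    intro u v huv hv
    by_cases hux : u = x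
    · subst hux
      right
      rw [h.subtreeNodes_lower]
      exact mem_subtreeNodes_trans hv h.mem_upper
    by_cases hup : u = p
    · subst hup
      by_cases hvx : v = x
      · left
        rw [hvx, h.subtreeNodes_lower]
        exact T.mem_subtreeNodes_self u
      · right
        rw [h.mem_subtreeNodes_upper]
        refine ⟨hv, fun hvx' => ?_⟩
        obtain h1 | ⟨y, h1, h2⟩ := mem_subtreeNodes_cases_child hvx'
        · exact absurd h1 hvx
        · exact ⟨y, h1, ⟨v, h2, huv⟩, h2⟩
    · right
      rwa [h.subtreeNodes_other hux hup]
  · intro y w hyw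
    by_cases hyx : y = x
    · subst hyx
      rw [h.subtreeNodes_lower]
      rw [h.parent_lower] at hyw
      exact hT.attached p w hyw
    by_cases hyp : y = p
    · subst hyp
      rw [h.parent_upper] at hyw
      cases hyw
      -- The upper node is now below `x` and needs a neighbour of `x` in its subtree. Either it is
      -- adjacent to `x` itself, or its neighbour lies in a child subtree of `x`; that one moves
      -- along, and `x` is attached to it.
      obtain ⟨z, hz, hyz⟩ := hT.attached x y h.parent
      obtain rfl | ⟨y', h1, h2⟩ := mem_subtreeNodes_cases_child hz
      · exact ⟨y, T'.mem_subtreeNodes_self y, hyz.symm⟩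
      · obtain ⟨z', h3, h4⟩ := hT.attached y' x h1
        exact ⟨z', h.mem_subtreeNodes_upper.2
          ⟨mem_subtreeNodes_trans h3 (mem_subtreeNodes_of_parent h1 h.mem_upper),
            fun _ => ⟨y', h1, ⟨z, h2, hyz⟩, h3⟩⟩, h4⟩
    rw [h.subtreeNodes_other hyx hyp]
    by_cases hN : T.parent y = some x ∧ ∃ z ∈ T.subtreeNodes y, S.Adj p z
    · rw [h.parent_moved y hN.1 hN.2] at hyw
      cases hyw
      exact hN.2
    · rw [h.parent_other y hyx hyp hN] at hyw
      exact hT.attached y w hyw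

/-- The inverse of a rotation is a rotation. -/
theorem symm (hT : IsLocalSTT S T) : IsRotationAt S T' p x T := by
  -- The children to be moved back are those that were moved. An unmoved child of `p` is
  -- incomparable to `x` in `T`, so its subtree contains no neighbour of `x`.
  have key : ∀ y, y ≠ x → y ≠ p → ((T'.parent y = some p ∧ ∃ z ∈ T'.subtreeNodes y, S.Adj x z) ↔
      (T.parent y = some x ∧ ∃ z ∈ T.subtreeNodes y, S.Adj p z)) := by
    intro y hyx hyp
    rw [h.subtreeNodes_other hyx hyp]
    constructor
    · rintro ⟨h1, z, h2, h3⟩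
      by_contra hN
      rw [h.parent_other y hyx hyp hN] at h1
      obtain h4 | h4 := hT.comparable x z h3
      · obtain h5 | h5 := subtreeNodes_total (mem_subtreeNodes_trans h4 h2)
          (T.mem_subtreeNodes_self x)
        · exact h.upper_notMem (parent_mem_subtreeNodes h5 hyx h1)
        · exact parent_notMem_subtreeNodes h1 (parent_mem_subtreeNodes h5 (Ne.symm hyx) h.parent)
      · obtain h5 | h5 := subtreeNodes_total h2 h4
        · exact h.upper_notMem (parent_mem_subtreeNodes h5 hyx h1)
        · exact parent_notMem_subtreeNodes h1 (parent_mem_subtreeNodes h5 (Ne.symm hyx) h.parent)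
    · rintro ⟨h1, h2⟩
      exact ⟨h.parent_moved y h1 h2, hT.attached y x h1⟩
  have hne : ∀ y, T'.parent y = some p → y ≠ x ∧ y ≠ p := by
    intro y hy
    refine ⟨?_, (parent_ne_self hy).symm⟩
    rintro rfl
    rw [h.parent_lower] at hy
    exact parent_ne_self hy rfl
  refine ⟨h.parent_upper, h.parent_lower.symm, h.parent, fun y h1 h2 => ?_, fun y h1 h2 h3 => ?_⟩
  · exact ((key y (hne y h1).1 (hne y h1).2).1 ⟨h1, h2⟩).1
  · rw [key y h2 h1] at h3
    exact (h.parent_other y h2 h1 h3).symm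

theorem mem_ancestors_lower {a : V} : a ∈ T'.ancestors x ↔ a = x ∨ a ∈ T.ancestors p ∧ a ≠ p := by
  by_cases hax : a = x
  · simp [hax, T'.mem_ancestors_self]
  by_cases hap : a = p
  · subst hap
    simp only [hax, ne_eq, not_true_eq_false, and_false, or_false, iff_false]
    exact fun hh => parent_notMem_subtreeNodes h.parent_upper hh
  · simp only [hax, hap, ne_eq, not_false_eq_true, and_true, false_or]
    change x ∈ T'.subtreeNodes a ↔ p ∈ T.subtreeNodes a
    rw [h.subtreeNodes_other hax hap]
    exact ⟨fun hh => parent_mem_subtreeNodes hh (Ne.symm hax) h.parent,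
      mem_subtreeNodes_of_parent h.parent⟩

theorem ncard_ancestors_lower [Finite V] : (T'.ancestors x).ncard = (T.ancestors p).ncard := by
  have : T'.ancestors x = insert x (T.ancestors p \ {p}) := by
    ext a
    rw [h.mem_ancestors_lower]
    simp
  rw [this, Set.ncard_insert_of_notMem, Set.ncard_sdiff_singleton_add_one (T.mem_ancestors_self p)]
  exact fun hh => notMem_ancestors_of_parent h.parent hh.1

end IsRotationAt

end Rotation

/-! ### Boundaries and their change under a rotation -/

section Boundary

variable {V : Type*} {S : SimpleGraph V} {T T' : RootedTreeOn V} {x p : V}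

/-- A boundary node is comparable with a node of the subtree; being outside, it lies above `x`. -/
theorem IsLocalSTT.boundary_subset_ancestors (hT : IsLocalSTT S T) (x : V) :
    boundary S (T.subtreeNodes x) ⊆ T.ancestors x \ {x} := by
  rintro b ⟨hb, u, hu, hub⟩
  refine ⟨?_, fun e => hb (e ▸ T.mem_subtreeNodes_self x)⟩
  obtain h1 | h1 := hT.comparable u b hub.symm
  · obtain h2 | h2 := subtreeNodes_total h1 hu
    · exact absurd h2 hb
    · exact h2
  · exact absurd (mem_subtreeNodes_trans h1 hu) hb

theorem IsLocalSTT.parent_mem_boundary (hT : IsLocalSTT S T) (hx : T.parent x = some p) :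
    p ∈ boundary S (T.subtreeNodes x) :=
  let ⟨z, hz, hpz⟩ := hT.attached x p hx
  ⟨parent_notMem_subtreeNodes hx, z, hz, hpz⟩

theorem IsLocalSTT.boundary_subset_insert (hT : IsLocalSTT S T) (hx : T.parent x = some p) :
    boundary S (T.subtreeNodes x) ⊆ insert p (boundary S (T.subtreeNodes p)) := by
  intro b hb
  obtain ⟨hbx, u, hu, hub⟩ := hb
  by_cases hbp : b ∈ T.subtreeNodes p
  · obtain ⟨h1, h2⟩ := hT.boundary_subset_ancestors x ⟨hbx, u, hu, hub⟩
    exact .inl (subtreeNodes_antisymm hbp (parent_mem_subtreeNodes h1 (Ne.symm h2) hx))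
  · exact .inr ⟨hbp, u, mem_subtreeNodes_trans hu
      (mem_subtreeNodes_of_parent hx (T.mem_subtreeNodes_self p)), hub⟩

/-- The strict inequality forces every boundary node of `T_p` to have its only neighbour in `T_p`
inside `T_x`. If a child subtree `T_y` of `x` moves to `p`, it is the only one, and it inherits all
these adjacencies; so the new boundary lies in that of `T_y` without `p`, at most `j + 1 - 1` nodes.
If none moves, only `x` can remain. -/
theorem IsRotationAt.ncard_boundary_upper [Finite V] (h : IsRotationAt S T x p T')
    (hT : IsLocalSTT S T) (hS : S.IsAcyclic) {j : ℕ} (hj : 1 ≤ j)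
    (hk : ∀ y, (boundary S (T.subtreeNodes y)).ncard ≤ j + 1)
    (hlt : (boundary S (T.subtreeNodes p)).ncard < (boundary S (T.subtreeNodes x)).ncard) :
    (boundary S (T'.subtreeNodes p)).ncard ≤ j := by
  -- The boundary of `T_x` lies in that of `T_p` together with `p`; by cardinality the two sets
  -- agree.
  have hpx : boundary S (T.subtreeNodes p) ⊆ boundary S (T.subtreeNodes x) := by
    rw [Set.eq_of_subset_of_ncard_le (hT.boundary_subset_insert h.parent)
      ((Set.ncard_insert_le _ _).trans hlt)]
    exact Set.subset_insert _ _
  have key : ∀ b ∈ boundary S (T'.subtreeNodes p), b = x ∨ ∃ y, T.parent y = some x ∧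
      (∃ z ∈ T.subtreeNodes y, S.Adj p z) ∧ b ∈ boundary S (T.subtreeNodes y) \ {p} := by
    rintro b ⟨hb, u, hu, hub⟩
    rw [h.mem_subtreeNodes_upper] at hb hu
    by_cases hux : u ∈ T.subtreeNodes x
    · obtain ⟨y, h1, h2, h3⟩ := hu.2 hux
      refine .inr ⟨y, h1, h2, ⟨fun hby => hb ⟨?_, fun _ => ⟨y, h1, h2, hby⟩⟩, u, h3, hub⟩, ?_⟩
      · exact mem_subtreeNodes_trans hby (mem_subtreeNodes_of_parent h1 h.mem_upper)
      · rintro rfl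
        exact hb ⟨T.mem_subtreeNodes_self b, fun hh => absurd hh h.upper_notMem⟩
    by_cases hbp : b ∈ T.subtreeNodes p
    · have hbx : b ∈ T.subtreeNodes x := by
        by_contra hbx
        exact hb ⟨hbp, fun hh => absurd hh hbx⟩
      have hbu : b ∈ T.subtreeNodes u := by
        obtain h1 | h1 := hT.comparable u b hub.symm
        · exact absurd (mem_subtreeNodes_trans h1 hbx) hux
        · exact h1
      have hxu : x ∈ T.subtreeNodes u := (subtreeNodes_total hbu hbx).resolve_left hux
      have hne : x ≠ u := fun e => hux (e ▸ T.mem_subtreeNodes_self x)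
      obtain rfl : u = p :=
        subtreeNodes_antisymm hu.1 (parent_mem_subtreeNodes hxu hne h.parent)
      obtain hbx' | ⟨y, h1, h2⟩ := mem_subtreeNodes_cases_child hbx
      · exact .inl hbx'
      · exact absurd ⟨hbp, fun _ => ⟨y, h1, ⟨b, h2, hub.symm⟩, h2⟩⟩ hb
    -- A node outside `T_p` has a neighbour in `T_x`, which must be `u` by uniqueness.
    · obtain ⟨-, u', hu', hub'⟩ := hpx ⟨hbp, u, hu.1, hub⟩
      exact absurd (hT.neighbor_unique hS hbp hu.1 (mem_subtreeNodes_trans hu' h.mem_upper)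
        hub hub' ▸ hu') hux
  by_cases hN : ∃ y, T.parent y = some x ∧ ∃ z ∈ T.subtreeNodes y, S.Adj p z
  · obtain ⟨y, hy, z, hz, hpz⟩ := hN
    have hpy : p ∈ boundary S (T.subtreeNodes y) :=
      ⟨fun hh => h.upper_notMem (mem_subtreeNodes_trans hh
        (mem_subtreeNodes_of_parent hy (T.mem_subtreeNodes_self x))), z, hz, hpz⟩
    have hsub : boundary S (T'.subtreeNodes p) ⊆ boundary S (T.subtreeNodes y) \ {p} := by
      intro b hb
      obtain rfl | ⟨y', hy', ⟨z', hz', hpz'⟩, hb'⟩ := key b hb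
      · exact ⟨hT.parent_mem_boundary hy, h.upper_ne.symm⟩
      · have hzz : z' = z := hT.neighbor_unique hS h.upper_notMem
          (mem_subtreeNodes_trans hz' (mem_subtreeNodes_of_parent hy' (T.mem_subtreeNodes_self x)))
          (mem_subtreeNodes_trans hz (mem_subtreeNodes_of_parent hy (T.mem_subtreeNodes_self x)))
          hpz' hpz
        subst hzz
        obtain rfl : y' = y := by
          by_contra hne
          obtain h1 | h1 := subtreeNodes_total hz hz'
          · exact parent_notMem_subtreeNodes hy' (parent_mem_subtreeNodes h1 (Ne.symm hne) hy)
          · exact parent_notMem_subtreeNodes hy (parent_mem_subtreeNodes h1 hne hy')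
        exact hb'
    have h1 := Set.ncard_le_ncard hsub
    have h2 := Set.ncard_sdiff_singleton_add_one hpy
    have h3 := hk y
    omega
  · have hsub : boundary S (T'.subtreeNodes p) ⊆ {x} := by
      intro b hb
      obtain hb' | ⟨y, h1, h2, -⟩ := key b hb
      · exact hb'
      · exact absurd ⟨y, h1, h2⟩ hN
    exact (Set.ncard_le_ncard hsub).trans ((Set.ncard_singleton x).trans_le hj)

end Boundary

/-! ### Composing and reversing pointer runs -/

section PointerRun

variable {V : Type*} {S : SimpleGraph V} {k : ℕ} {T T' T'' : RootedTreeOn V} {x x' x'' : V}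
  {L L' : List V} {m m' : ℕ}

theorem PointerRun.rotationSeq (h : PointerRun S k T x T' x' L m) : RotationSeq S k T T' L := by
  induction h with
  | done T x hT => exact .nil T hT
  | move _ _ _ _ _ _ _ _ _ ih => exact ih
  | rotate T T₁ T' x x' L m hT rot _ ih => exact .cons T T₁ T' x L hT rot ih

theorem PointerRun.isKCut_left (h : PointerRun S k T x T' x' L m) : IsKCut S k T := by
  induction h with
  | done T x hT => exact hT
  | move _ _ _ _ _ _ _ _ _ ih => exact ih
  | rotate T T₁ T' x x' L m hT rot _ ih => exact hT

theorem PointerRun.mono {l : ℕ} (hkl : k ≤ l) (h : PointerRun S k T x T' x' L m) :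
    PointerRun S l T x T' x' L m := by
  have hc : ∀ T : RootedTreeOn V, IsKCut S k T → IsKCut S l T :=
    fun T hT => ⟨hT.1, fun x => (hT.2 x).trans hkl⟩
  induction h with
  | done T x hT => exact .done T x (hc T hT)
  | move T T' x y x' L m hmove _ ih => exact .move T T' x y x' L m hmove ih
  | rotate T T₁ T' x x' L m hT rot _ ih => exact .rotate T T₁ T' x x' L m (hc T hT) rot ih

theorem PointerRun.append (h : PointerRun S k T x T' x' L m)
    (h' : PointerRun S k T' x' T'' x'' L' m') :
    PointerRun S k T x T'' x'' (L ++ L') (m + m') := by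
  induction h with
  | done T x hT => simpa using h'
  | move T T' x y x' L m hmove _ ih =>
    rw [Nat.add_right_comm]
    exact .move T T'' x y x'' _ _ hmove (ih h')
  | rotate T T₁ T' x x' L m hT rot _ ih =>
    exact .rotate T T₁ T'' x x'' _ _ hT rot (ih h')

/-- To undo a rotation at `x`, the pointer steps down to `p`, rotates there and steps down to `x`
again: two extra moves per rotation. -/
theorem PointerRun.reverse (hS : S.Preconnected) (h : PointerRun S k T x T' x' L m) :
    ∃ L', L'.length = L.length ∧ PointerRun S k T' x' T x L' (m + 2 * L.length) := by
  induction h with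
  | done T x hT => exact ⟨[], rfl, .done T x hT⟩
  | move T T' x y x' L m hmove rest ih =>
    obtain ⟨L', hL', hrun⟩ := ih
    refine ⟨L', hL', ?_⟩
    have h1 := hrun.append
      (.move T T y x x [] 0 (Or.symm hmove) (.done T x rest.isKCut_left))
    rw [List.append_nil] at h1
    convert h1 using 1
    ring
  | rotate T T₁ T' x x' L m hT rot rest ih =>
    obtain ⟨L', hL', hrun⟩ := ih
    obtain ⟨p, hp⟩ := rot.exists_isRotationAt
    have h1 := hrun.append
      (.move T₁ T x p x [p] 1 (.inr hp.parent_upper)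
        (.rotate T₁ T T p x [] 1 rest.isKCut_left (hp.symm (hT.1.isLocalSTT hS)).isRotation
          (.move T T p x x [] 0 (.inr hp.parent) (.done T x hT))))
    refine ⟨_, ?_, by convert h1 using 1; simp; ring⟩
    simp [hL']

end PointerRun

/-! ### From `(j + 1)`-cut trees to `j`-cut trees -/

section Reduction

variable {V : Type*} [Finite V] {S : SimpleGraph V} {T T' : RootedTreeOn V} {x p : V} {j : ℕ}

/-- The nodes whose subtrees have a boundary of more than `j` nodes. -/
def overfull (S : SimpleGraph V) (j : ℕ) (T : RootedTreeOn V) : Set V :=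
  {x | j < (boundary S (T.subtreeNodes x)).ncard}

theorem isKCut_of_overfull_eq_empty (hT : IsLocalSTT S T) (h : ∀ y, y ∉ overfull S j T) :
    IsKCut S j T :=
  ⟨hT.isSTT, fun y => not_lt.1 (h y)⟩

/-- An overfull node of least depth has more than `j` boundary nodes; these are proper ancestors,
none of them overfull. -/
theorem ncard_overfull_le (hT : IsLocalSTT S T) (j : ℕ) :
    (overfull S j T).ncard ≤ Nat.card V - (j + 1) := by
  obtain he | hne := (overfull S j T).eq_empty_or_nonempty
  · simp [he]
  obtain ⟨x, hx, hmin⟩ := (overfull S j T).toFinite.exists_minimalFor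
    (fun x => (T.ancestors x).ncard) _ hne
  have hsub : T.ancestors x \ {x} ⊆ (overfull S j T)ᶜ := by
    rintro a ⟨ha, hax⟩ hbad
    have hlt : T.ancestors a ⊂ T.ancestors x :=
      ⟨fun b hb => mem_subtreeNodes_trans ha hb,
        fun hh => hax (subtreeNodes_antisymm (hh (T.mem_ancestors_self x)) ha)⟩
    have := Set.ncard_lt_ncard hlt
    have h2 := hmin hbad this.le
    simp only at h2
    omega
  have h1 := Set.ncard_le_ncard ((hT.boundary_subset_ancestors x).trans hsub)
  have h2 := Set.ncard_add_ncard_compl (overfull S j T)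
  have h3 : j < (boundary S (T.subtreeNodes x)).ncard := hx
  omega

theorem IsRotationAt.overfull_eq (h : IsRotationAt S T x p T') (hT : IsLocalSTT S T)
    (hS : S.IsAcyclic) (hj : 1 ≤ j) (hk : ∀ y, (boundary S (T.subtreeNodes y)).ncard ≤ j + 1)
    (hx : x ∈ overfull S j T) (hp : p ∉ overfull S j T) :
    overfull S j T' = overfull S j T \ {x} := by
  have hp' : (boundary S (T.subtreeNodes p)).ncard ≤ j := not_lt.1 hp
  ext y
  simp only [Set.mem_sdiff, Set.mem_singleton_iff]
  by_cases hyx : y = x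
  · subst hyx
    simp only [not_true_eq_false, and_false, iff_false]
    rw [overfull, Set.mem_ofPred_eq, h.subtreeNodes_lower]
    exact hp
  by_cases hyp : y = p
  · subst hyp
    simp only [hp, false_and, iff_false]
    exact not_lt.2 (h.ncard_boundary_upper hT hS hj hk (hp'.trans_lt hx))
  · simp only [hyx, not_false_eq_true, and_true]
    rw [overfull, Set.mem_ofPred_eq, h.subtreeNodes_other hyx hyp, overfull, Set.mem_ofPred_eq]

/-- A depth-first traversal that rotates at each overfull child of the current node. The set `D`
holds the nodes whose subtrees are finished. -/
theorem exists_pointerRun_traversal (hS : S.IsAcyclic) (hj : 1 ≤ j) (N : ℕ) :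
    ∀ (T : RootedTreeOn V) (x : V) (D : Set V), IsLocalSTT S T →
      (∀ y, (boundary S (T.subtreeNodes y)).ncard ≤ j + 1) →
      (∀ d ∈ D, d ∉ overfull S j T) →
      (∀ d ∈ D, ∀ y, T.parent y = some d → y ∈ D) →
      (∀ a ∈ T.ancestors x, a ∉ overfull S j T ∧ a ∉ D) →
      (overfull S j T).ncard + 2 * Dᶜ.ncard ≤ N + (T.ancestors x).ncard →
      ∃ T' L m, IsKCut S j T' ∧ PointerRun S (j + 1) T x T' T'.root L m ∧
        L.length ≤ (overfull S j T).ncard ∧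
        m + (T.ancestors x).ncard ≤ (overfull S j T).ncard + 2 * Dᶜ.ncard := by
  -- The potential is the number of overfull nodes plus twice the number of unfinished nodes, minus
  -- the number of ancestors of the pointer (itself included). Each pointer move lowers it by one:
  -- stepping to a child and rotating there removes an overfull node at equal depth, a plain descent
  -- adds an ancestor, and an ascent finishes a node but loses an ancestor.
  induction N with
  | zero =>
    intro T x D hT hk hD1 hD2 hx hN
    -- All ancestors of `x` are unfinished, so the potential is positive and this case is void.
    have h1 : (T.ancestors x).ncard ≤ Dᶜ.ncard := Set.ncard_le_ncard fun a ha => (hx a ha).2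
    have h2 : 0 < (T.ancestors x).ncard :=
      (Set.ncard_pos (Set.toFinite _)).2 ⟨x, T.mem_ancestors_self x⟩
    omega
  | succ N ih =>
    intro T x D hT hk hD1 hD2 hx hN
    have hcut : IsKCut S (j + 1) T := ⟨hT.isSTT, hk⟩
    obtain ⟨hxo, hxD⟩ := hx x (T.mem_ancestors_self x)
    by_cases hbad : ∃ c, T.parent c = some x ∧ c ∈ overfull S j T
    · obtain ⟨c, hc, hco⟩ := hbad
      obtain ⟨T₁, hrot⟩ := exists_isRotationAt S hc
      have ho := hrot.overfull_eq hT hS hj hk hco hxo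
      have hcard := Set.ncard_sdiff_singleton_add_one hco
      have hanc := hrot.ncard_ancestors_lower
      have hcD : c ∉ D := fun h => hD1 c h hco
      have hk₁ : ∀ y, (boundary S (T₁.subtreeNodes y)).ncard ≤ j + 1 := by
        intro y
        by_cases hyc : y = c
        · rw [hyc, hrot.subtreeNodes_lower]
          exact hk x
        by_cases hyx : y = x
        · subst hyx
          have : y ∉ overfull S j T₁ := fun hh => hxo (ho ▸ hh).1
          exact (not_lt.1 this).trans (Nat.le_succ j)
        · rw [hrot.subtreeNodes_other hyc hyx]
          exact hk y
      rw [← ho] at hcard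
      obtain ⟨T', L, m, hT', hrun, hL, hm⟩ := ih T₁ c D (hrot.isLocalSTT hT) hk₁
        (fun d hd hd' => hD1 d hd (ho ▸ hd').1)
        (by
          intro d hd y hy
          -- Changed parents are never finished nodes: the new ones are `c`, `x` and the old parent
          -- of `x`.
          have hdx : d ≠ x := fun e => hxD (e ▸ hd)
          have hdc : d ≠ c := fun e => hcD (e ▸ hd)
          by_cases hyc : y = c
          · rw [hyc, hrot.parent_lower] at hy
            exact absurd hd (hx d (mem_subtreeNodes_of_parent hy (T.mem_subtreeNodes_self d))).2
          by_cases hyx : y = x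
          · rw [hyx, hrot.parent_upper] at hy
            exact absurd (Option.some.inj hy).symm hdc
          by_cases hM : T.parent y = some c ∧ ∃ z ∈ T.subtreeNodes y, S.Adj x z
          · rw [hrot.parent_moved y hM.1 hM.2] at hy
            exact absurd (Option.some.inj hy).symm hdx
          · rw [hrot.parent_other y hyc hyx hM] at hy
            exact hD2 d hd y hy)
        (by
          intro a ha
          rw [hrot.mem_ancestors_lower] at ha
          rw [ho]
          obtain rfl | ⟨h1, -⟩ := ha
          · exact ⟨fun hh => hh.2 rfl, hcD⟩
          · exact ⟨fun hh => (hx a h1).1 hh.1, (hx a h1).2⟩)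
        (by omega)
      refine ⟨T', c :: L, m + 1, hT', .move _ _ _ c _ _ _ (.inr hc)
        (.rotate _ _ _ _ _ _ _ hcut hrot.isRotation hrun), ?_, ?_⟩
      · rw [List.length_cons]; omega
      · omega
    push Not at hbad
    by_cases hnew : ∃ c, T.parent c = some x ∧ c ∉ D
    · obtain ⟨c, hc, hcD⟩ := hnew
      have hanc := ncard_ancestors_of_parent hc
      obtain ⟨T', L, m, hT', hrun, hL, hm⟩ := ih T c D hT hk hD1 hD2
        (by
          intro a ha
          rw [ancestors_of_parent hc] at ha
          obtain rfl | ha := ha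
          · exact ⟨hbad a hc, hcD⟩
          · exact hx a ha)
        (by omega)
      exact ⟨T', L, m + 1, hT', .move _ _ _ c _ _ _ (.inr hc) hrun, hL, by omega⟩
    push Not at hnew
    cases hq : T.parent x with
    | none =>
      obtain rfl := eq_root_of_parent_eq_none hq
      -- `D` is closed under children, so once it contains those of the root, the whole tree is
      -- finished.
      have hall : ∀ y, y = T.root ∨ y ∈ D := by
        intro y
        induction T.reaches_root y using ReflTransGen.head_induction_on with
        | refl => exact .inl rfl
        | head hyw _ ih' =>
          obtain rfl | h := ih'
          · exact .inr (hnew _ hyw)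
          · exact .inr (hD2 _ h _ hyw)
      have h1 : (T.ancestors T.root).ncard ≤ Dᶜ.ncard := Set.ncard_le_ncard fun a ha => (hx a ha).2
      refine ⟨T, [], 0, isKCut_of_overfull_eq_empty hT fun y => ?_, .done _ _ hcut,
        Nat.zero_le _, by omega⟩
      obtain rfl | h := hall y
      · exact hxo
      · exact hD1 y h
    | some q =>
      have hanc := ncard_ancestors_of_parent hq
      have hD : (insert x D)ᶜ.ncard + 1 = Dᶜ.ncard := by
        have h1 := Set.ncard_add_ncard_compl D
        have h2 := Set.ncard_add_ncard_compl (insert x D)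
        have h3 := Set.ncard_insert_of_notMem hxD
        omega
      obtain ⟨T', L, m, hT', hrun, hL, hm⟩ := ih T q (insert x D) hT hk
        (by
          rintro d (rfl | hd)
          · exact hxo
          · exact hD1 d hd)
        (by
          rintro d (rfl | hd) y hy
          · exact .inr (hnew y hy)
          · exact .inr (hD2 d hd y hy))
        (by
          intro a ha
          have h1 := hx a (ancestors_of_parent hq ▸ .inr ha)
          refine ⟨h1.1, ?_⟩
          rintro (rfl | h)
          · exact notMem_ancestors_of_parent hq ha
          · exact h1.2 h)
        (by omega)
      exact ⟨T', L, m + 1, hT', .move _ _ _ q _ _ _ (.inl hq) hrun, hL, by omega⟩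

/-- A `(j + 1)`-cut tree can be transformed into a `j`-cut tree. -/
theorem exists_pointerRun_pred (hS : S.IsTree) (hj : 1 ≤ j) (hT : IsKCut S (j + 1) T) :
    ∃ T' L m, IsKCut S j T' ∧ PointerRun S (j + 1) T T.root T' T'.root L m ∧
      L.length ≤ Nat.card V - (j + 1) ∧ m ≤ 3 * Nat.card V := by
  have hloc := hT.1.isLocalSTT hS.connected.preconnected
  have hroot : T.root ∉ overfull S j T := by
    have h0 : boundary S (T.subtreeNodes T.root) = ∅ := by
      ext b
      simp [boundary, T.mem_subtreeNodes_root b]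
    simp [overfull, h0]
  -- With `D` empty the potential is below `n + 2n`, whence the bound `3n`.
  obtain ⟨T', L, m, h1, h2, h3, h4⟩ := exists_pointerRun_traversal hS.isAcyclic hj
    ((overfull S j T).ncard + 2 * (∅ : Set V)ᶜ.ncard) T T.root ∅ hloc hT.2 (by simp) (by simp)
    (by rw [ancestors_root]; rintro a rfl; exact ⟨hroot, Set.notMem_empty _⟩) (by omega)
  have h5 := ncard_overfull_le hloc j
  have h6 : (∅ : Set V)ᶜ.ncard = Nat.card V := by simp
  exact ⟨T', L, m, h1, h2, by omega, by omega⟩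

end Reduction

/-! ### `1`-cut trees and moving the root -/

section OneCut

variable {V : Type*} [Finite V] {S : SimpleGraph V} {T T' : RootedTreeOn V} {x p : V}

theorem IsLocalSTT.eq_of_mem_boundary_of_one (hT : IsLocalSTT S T)
    (hk : ∀ y, (boundary S (T.subtreeNodes y)).ncard ≤ 1) (hx : T.parent x = some p) {b : V}
    (hb : b ∈ boundary S (T.subtreeNodes x)) : b = p :=
  (Set.ncard_le_one (Set.toFinite _)).1 (hk x) _ hb _ (hT.parent_mem_boundary hx)

/-- If the neighbour of `p` were below a child `c` of `x`, both `p` and `x` would be in the boundary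
of `T_c`. -/
theorem IsLocalSTT.adj_of_parent_of_one (hT : IsLocalSTT S T)
    (hk : ∀ y, (boundary S (T.subtreeNodes y)).ncard ≤ 1) (hx : T.parent x = some p) :
    S.Adj x p := by
  obtain ⟨z, hz, hpz⟩ := hT.attached x p hx
  obtain rfl | ⟨c, hc, hzc⟩ := mem_subtreeNodes_cases_child hz
  · exact hpz.symm
  · refine absurd (hT.eq_of_mem_boundary_of_one hk hc ⟨fun hh => ?_, z, hzc, hpz⟩)
      (parent_ne_self hx)
    exact parent_notMem_subtreeNodes hx (mem_subtreeNodes_trans hh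
      (mem_subtreeNodes_of_parent hc (T.mem_subtreeNodes_self x)))

theorem IsLocalSTT.parent_of_adj_of_one (hT : IsLocalSTT S T)
    (hk : ∀ y, (boundary S (T.subtreeNodes y)).ncard ≤ 1) {u v : V} (huv : S.Adj u v) :
    T.parent u = some v ∨ T.parent v = some u := by
  suffices H : ∀ u v, S.Adj u v → v ∈ T.subtreeNodes u → T.parent v = some u by
    obtain h | h := hT.comparable u v huv
    · exact .inl (H v u huv.symm h)
    · exact .inr (H u v huv h)
  intro u v huv hv
  obtain rfl | ⟨c, hc, hvc⟩ := mem_subtreeNodes_cases_child hv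
  · exact absurd huv (S.irrefl)
  obtain rfl | ⟨d, hd, hvd⟩ := mem_subtreeNodes_cases_child hvc
  · exact hc
  refine absurd (hT.eq_of_mem_boundary_of_one hk hd ⟨fun hh => ?_, v, hvd, huv⟩)
    (parent_ne_self hc)
  exact parent_notMem_subtreeNodes hc (mem_subtreeNodes_trans hh
    (mem_subtreeNodes_of_parent hd (T.mem_subtreeNodes_self c)))

/-- A `1`-cut tree is determined by its root. -/
theorem IsLocalSTT.eq_of_root_eq_of_one (hT : IsLocalSTT S T) (hT' : IsLocalSTT S T')
    (hk : ∀ y, (boundary S (T.subtreeNodes y)).ncard ≤ 1)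
    (hk' : ∀ y, (boundary S (T'.subtreeNodes y)).ncard ≤ 1) (hr : T.root = T'.root) : T = T' := by
  refine RootedTreeOn.ext (funext fun y => ?_) hr
  induction T.reaches_root y using ReflTransGen.head_induction_on with
  | refl => rw [T.parent_root, hr, T'.parent_root]
  | head hyw _ ih =>
    -- The edge is a parent edge in `T'` too; the opposite direction contradicts the equality of
    -- parents already known for the upper node.
    obtain h | h := hT'.parent_of_adj_of_one hk' (hT.adj_of_parent_of_one hk hyw)
    · rw [hyw, h]
    · rw [h] at ih
      exact absurd (mem_subtreeNodes_of_parent ih (T.mem_subtreeNodes_self _))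
        (parent_notMem_subtreeNodes hyw)

/-- Rotating at the child of the root towards `T'.root` removes the old root from the ancestors of
`T'.root` and keeps the tree `1`-cut. Once the roots agree, so do the trees. -/
theorem exists_pointerRun_of_one (hS : S.IsTree) (hT' : IsKCut S 1 T') (N : ℕ) :
    ∀ T : RootedTreeOn V, IsKCut S 1 T → (T.ancestors T'.root).ncard ≤ N + 1 →
      ∃ L m, PointerRun S 1 T T.root T' T'.root L m ∧ L.length ≤ N ∧ m ≤ N := by
  have hpre := hS.connected.preconnected
  have hfin : ∀ T : RootedTreeOn V, IsKCut S 1 T → T.root = T'.root →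
      PointerRun S 1 T T.root T' T'.root [] 0 := by
    intro T hT hr
    obtain rfl := (hT.1.isLocalSTT hpre).eq_of_root_eq_of_one (hT'.1.isLocalSTT hpre) hT.2 hT'.2 hr
    exact .done _ _ hT
  induction N with
  | zero =>
    intro T hT hN
    exact ⟨[], 0, hfin T hT ((Set.ncard_le_one (Set.toFinite _)).1 hN _
      (T.mem_subtreeNodes_root _) _ (T.mem_ancestors_self _)), le_rfl, le_rfl⟩
  | succ N ih =>
    intro T hT hN
    have hloc := hT.1.isLocalSTT hpre
    obtain hr | ⟨c, hc, hrc⟩ := mem_subtreeNodes_cases_child (T.mem_subtreeNodes_root T'.root)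
    · exact ⟨[], 0, hfin T hT hr.symm, Nat.zero_le _, Nat.zero_le _⟩
    obtain ⟨T₁, hrot⟩ := exists_isRotationAt S hc
    have hroot : c = T₁.root := by
      refine eq_root_of_parent_eq_none ?_
      rw [hrot.parent_lower, T.parent_root]
    have hb : boundary S (T.subtreeNodes T.root) = ∅ := by
      ext b
      simp [boundary, T.mem_subtreeNodes_root b]
    have hlt : (boundary S (T.subtreeNodes T.root)).ncard < (boundary S (T.subtreeNodes c)).ncard := by
      rw [hb, Set.ncard_empty]
      exact (Set.ncard_pos (Set.toFinite _)).2 ⟨_, hloc.parent_mem_boundary hc⟩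
    have hT₁ : IsKCut S 1 T₁ := by
      refine ⟨(hrot.isLocalSTT hloc).isSTT, fun y => ?_⟩
      by_cases hyc : y = c
      · rw [hyc, hrot.subtreeNodes_lower]
        exact hT.2 _
      by_cases hyr : y = T.root
      · rw [hyr]
        exact hrot.ncard_boundary_upper hloc hS.isAcyclic le_rfl
          (fun y => (hT.2 y).trans (Nat.le_succ 1)) hlt
      · rw [hrot.subtreeNodes_other hyc hyr]
        exact hT.2 y
    -- Otherwise a moved child subtree of `c` would have both `c` and the old root in its boundary.
    have hnot : T.root ∉ T₁.ancestors T'.root := by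
      intro hh
      obtain ⟨y, hy, ⟨z, hz, hrz⟩, -⟩ := (hrot.mem_subtreeNodes_upper.1 hh).2 hrc
      refine hrot.upper_ne (hloc.eq_of_mem_boundary_of_one hT.2 hy ⟨fun hh' => ?_, z, hz, hrz⟩)
      exact hrot.upper_notMem (mem_subtreeNodes_trans hh'
        (mem_subtreeNodes_of_parent hy (T.mem_subtreeNodes_self c)))
    have hsub : insert T.root (T₁.ancestors T'.root) ⊆ T.ancestors T'.root := by
      rintro a (rfl | ha)
      · exact T.mem_subtreeNodes_root _
      · by_cases hac : a = c
        · exact hac ▸ hrc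
        · have har : a ≠ T.root := fun e => hnot (e ▸ ha)
          have := hrot.subtreeNodes_other hac har
          exact (this ▸ ha : T'.root ∈ T.subtreeNodes a)
    have hcard := Set.ncard_le_ncard hsub
    rw [Set.ncard_insert_of_notMem hnot] at hcard
    obtain ⟨L, m, hrun, hL, hm⟩ := ih T₁ hT₁ (by omega)
    rw [← hroot] at hrun
    exact ⟨c :: L, m + 1, .move _ _ _ c _ _ _ (.inr hc)
      (.rotate _ _ _ _ _ _ _ hT hrot.isRotation hrun), by simpa using hL, by omega⟩

end OneCut

/-! ### Assembling the passes and counting -/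

section Main

variable {V : Type*} [Finite V] {S : SimpleGraph V} {T T' : RootedTreeOn V}

/-- The passes cost the sum of `n - (i + 1)` over `i = 1, ..., j`; the bound is doubled to avoid
dividing by two. -/
theorem exists_pointerRun_to_one (hS : S.IsTree) (j : ℕ) (hj : j + 1 ≤ Nat.card V) :
    ∀ T : RootedTreeOn V, IsKCut S (j + 1) T →
      ∃ U L m, IsKCut S 1 U ∧ PointerRun S (j + 1) T T.root U U.root L m ∧
        2 * (L.length : ℤ) ≤ 2 * j * Nat.card V - (j + 1) * (j + 2) + 2 ∧
        m ≤ 3 * j * Nat.card V := by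
  induction j with
  | zero => exact fun T hT => ⟨T, [], 0, hT, .done _ _ hT, by simp, by simp⟩
  | succ j ih =>
    intro T hT
    obtain ⟨T₁, L₁, m₁, hT₁, hrun₁, hL₁, hm₁⟩ := exists_pointerRun_pred hS (Nat.le_add_left 1 j) hT
    obtain ⟨U, L₂, m₂, hU, hrun₂, hL₂, hm₂⟩ := ih (by omega) T₁ hT₁
    refine ⟨U, L₁ ++ L₂, m₁ + m₂, hU, hrun₁.append (hrun₂.mono (Nat.le_succ _)), ?_, ?_⟩
    · have : (L₁.length : ℤ) ≤ Nat.card V - (j + 1 + 1) := by omega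
      rw [List.length_append]
      push_cast
      linarith
    · linarith

theorem exists_pointerRun_of_le_card (hS : S.IsTree) {k : ℕ} (hk : 1 ≤ k) (hkn : k ≤ Nat.card V)
    (hT : IsKCut S k T) (hT' : IsKCut S k T') :
    ∃ L m, PointerRun S k T T.root T' T'.root L m ∧
      (L.length : ℤ) ≤ (2 * (k : ℤ) - 1) * Nat.card V - ((k : ℤ) + 1) * k + 1 ∧
      m + L.length ≤ 12 * (k * Nat.card V) := by
  obtain ⟨j, rfl⟩ := Nat.exists_eq_add_of_le' hk
  obtain ⟨U, L₁, m₁, hU, hrun₁, hL₁, hm₁⟩ := exists_pointerRun_to_one hS j hkn T hT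
  obtain ⟨U', L₂, m₂, hU', hrun₂, hL₂, hm₂⟩ := exists_pointerRun_to_one hS j hkn T' hT'
  obtain ⟨L₃, m₃, hrun₃, hL₃, hm₃⟩ := exists_pointerRun_of_one hS hU' (Nat.card V - 1) U hU
    ((Set.ncard_le_card _).trans (by omega))
  obtain ⟨L₄, hL₄, hrun₄⟩ := hrun₂.reverse hS.connected.preconnected
  refine ⟨_, _, (hrun₁.append (hrun₃.mono hk)).append hrun₄, ?_, ?_⟩
  · have : (L₃.length : ℤ) ≤ Nat.card V - 1 := by omega
    simp only [List.length_append, hL₄]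
    push_cast
    linarith
  -- With `j = k - 1`, the passes make at most `6jn` moves and `2jn` rotations, the reversal adds at
  -- most `2jn` moves, and moving the root costs at most `2n`: in all `10jn + 2n`, below `12kn`.
  · simp only [List.length_append, hL₄]
    zify at hm₁ hm₂ hm₃ hL₃ ⊢
    have h3 : (L₃.length : ℤ) ≤ Nat.card V := by omega
    have h4 : (m₃ : ℤ) ≤ Nat.card V := by omega
    nlinarith [Int.natCast_nonneg j, Int.natCast_nonneg (Nat.card V),
      mul_nonneg (Int.natCast_nonneg j) (Int.natCast_nonneg (Nat.card V))]

end Main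

theorem theorem2 :
    ∃ c : ℕ, ∀ (V : Type*) [Finite V] (S : SimpleGraph V), S.IsTree →
      ∀ (n : ℕ), n = Nat.card V →
      ∀ (k : ℕ), 1 ≤ k →
      ∀ (T T' : RootedTreeOn V), IsKCut S k T → IsKCut S k T' →
        ∃ L : List V,
          RotationSeq S k T T' L ∧
          (k ≤ n → (L.length : ℤ) ≤ (2 * (k : ℤ) - 1) * n - ((k : ℤ) + 1) * k + 1) ∧
          ∃ (m : ℕ) (x' : V),
            PointerRun S k T T.root T' x' L m ∧
            m + L.length ≤ c * (k ^ 2 * n) := by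
  refine ⟨12, fun V _ S hS n hn k hk T T' hT hT' => ?_⟩
  subst hn
  by_cases hkn : k ≤ Nat.card V
  · obtain ⟨L, m, hrun, hL, hm⟩ := exists_pointerRun_of_le_card hS hk hkn hT hT'
    refine ⟨L, hrun.rotationSeq, fun _ => hL, m, _, hrun, hm.trans ?_⟩
    gcongr
    nlinarith
  -- For `k > n` every boundary has at most `n` nodes, so both trees are `n`-cut and the case `k =
  -- n` applies.
  · have hcut : ∀ T : RootedTreeOn V, IsKCut S k T → IsKCut S (Nat.card V) T :=
      fun T hT => ⟨hT.1, fun x => Set.ncard_le_card _⟩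
    have hpos : 1 ≤ Nat.card V := Nat.card_pos_iff.2 ⟨hS.connected.nonempty, inferInstance⟩
    obtain ⟨L, m, hrun, -, hm⟩ :=
      exists_pointerRun_of_le_card hS hpos le_rfl (hcut T hT) (hcut T' hT')
    have hrun' := hrun.mono (not_le.1 hkn).le
    refine ⟨L, hrun'.rotationSeq, fun h => absurd h hkn, m, _, hrun', hm.trans ?_⟩
    gcongr
    nlinarith
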